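/- Let $p,q,r\ge 0$ be integers with $p+q$ even, let $A_1,\dots,A_p$ and $S_1,\dots,S_q$ be points of $\mathbb Z^2$, and let $I=\{I_1,\dots,I_r\}\subset\mathbb Z^2$ be a finite set of $r$ distinct points, listed in a fixed order. Lattice paths consist of unit horizontal and vertical steps in the positive direction (a path without steps is allowed), and $\mathcal P(A\to E)$ denotes the number of lattice paths from $A$ to $E$. Define a $p\times p$ matrix $Q$ and a $p\times q$ matrix $H$ by $$Q_{i,j}=\sum_{1\le s<t\le r}\big(\mathcal P(A_i\to I_s)\,\mathcal P(A_j\to I_t)-\mathcal P(A_j\to I_s)\,\mathcal P(A_i\to I_t)\big),\qquad H_{i,j}=\mathcal P(A_i\to S_j).$$ Then $$\operatorname{Pf}\begin{pmatrix}Q&H\\-H^t&0\end{pmatrix}=(-1)^{\binom q2}\sum_{\pi\in S_p}(\operatorname{sgn}\pi)\cdot\mathcal P^{\mathrm{nonint}}(\mathbf A_\pi\to\mathbf S\cup I).$$ Here $S_p$ in the range of summation is the symmetric group, and $\mathcal P^{\mathrm{nonint}}(\mathbf A_\pi\to\mathbf S\cup I)$ is the number of families $(P_1,\dots,P_p)$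 of lattice paths, no two of which have a vertex in common, such that $P_k$ runs from $A_{\pi(k)}$ to $S_k$ for $k=1,\dots,q$, and from $A_{\pi(k)}$ to $I_{j_k}$ for $k=q+1,\dots,p$, with indices $j_{q+1}<j_{q+2}<\dots<j_p$ (this number is $0$ if $p<q$). The Pfaffian of a skew-symmetric $2n\times 2n$ matrix $M$ is $$\operatorname{Pf}M=\sum_{\mu}(-1)^{\mathrm{cr}(\mu)}\prod_{\substack{i<j\\ \{i,j\}\in\mu}}M_{i,j},$$ where $\mu$ runs over all perfect matchings of $\{1,\dots,2n\}$ and $\mathrm{cr}(\mu)$ is the number of quadruples $i<j<k<l$ with $\{i,k\},\{j,l\}\in\mu$. -/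

import Mathlib

/-- The number of crossings of a pairing `σ` of `Fin m`: quadruples `i < j < k < l` such that
`i` is paired with `k` and `j` is paired with `l`. -/
def crossings {m : ℕ} (σ : Equiv.Perm (Fin m)) : ℕ :=
  (Finset.univ.filter fun x : Fin m × Fin m × Fin m × Fin m =>
    x.1 < x.2.1 ∧ x.2.1 < x.2.2.1 ∧ x.2.2.1 < x.2.2.2 ∧
      σ x.1 = x.2.2.1 ∧ σ x.2.1 = x.2.2.2).card

/-- Perfect matchings of the complete graph on `Fin m`, encoded by the involution without fixed
points that sends each vertex to its partner. -/
def perfectMatchings (m : ℕ) : Finset (Equiv.Perm (Fin m)) :=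
  Finset.univ.filter fun σ => ∀ i, σ (σ i) = i ∧ σ i ≠ i

/-- The Pfaffian of an `m × m` matrix (meant for `m` even and skew-symmetric matrices): the sum over
all perfect matchings of `Fin m`, signed by the parity of the number of crossings, of the product
of the entries `M i j` over the matched pairs `i < j`. -/
def pfaffian {R : Type*} [CommRing R] {m : ℕ} (M : Matrix (Fin m) (Fin m) R) : R :=
  ∑ σ ∈ perfectMatchings m,
    (-1) ^ crossings σ * ∏ i ∈ Finset.univ.filter (fun i => i < σ i), M i (σ i)

/-- A unit horizontal or vertical step in the positive direction. -/
def LatticeStep (u v : ℤ × ℤ) : Prop :=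
  v = (u.1 + 1, u.2) ∨ v = (u.1, u.2 + 1)

/-- `l` is the list of successive vertices of a lattice path from `a` to `e` that consists of unit
horizontal and vertical steps in the positive direction. The path without steps is allowed. -/
def IsLatticePath (a e : ℤ × ℤ) (l : List (ℤ × ℤ)) : Prop :=
  l.head? = some a ∧ l.getLast? = some e ∧ l.IsChain LatticeStep

/-- The number of lattice paths from `a` to `e`. -/
noncomputable def pathCount (a e : ℤ × ℤ) : ℕ :=
  {l : List (ℤ × ℤ) | IsLatticePath a e l}.ncard

/-- `P` is a family of pairwise vertex-disjoint lattice paths with starting points `A 0, …, A (p-1)`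
whose first `q` members end in `S 0, …, S (q-1)`, in this order, and whose remaining members
end in points of `I` with increasing indices. (There is no such family if `p < q`.) -/
def IsNonintFamily {p q r : ℕ} (A : Fin p → ℤ × ℤ) (S : Fin q → ℤ × ℤ) (I : Fin r → ℤ × ℤ)
    (P : Fin p → List (ℤ × ℤ)) : Prop :=
  (∀ k : Fin q, ∃ h : (k : ℕ) < p, IsLatticePath (A ⟨k, h⟩) (S k) (P ⟨k, h⟩)) ∧
  (∃ j : {k : Fin p // q ≤ (k : ℕ)} → Fin r, StrictMono j ∧
    ∀ k : {k : Fin p // q ≤ (k : ℕ)}, IsLatticePath (A k) (I (j k)) (P k)) ∧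
  Pairwise fun k l => (P k).Disjoint (P l)

/-- The number of nonintersecting families from `A` to `S ∪ I`. -/
noncomputable def nonintCount {p q r : ℕ} (A : Fin p → ℤ × ℤ) (S : Fin q → ℤ × ℤ)
    (I : Fin r → ℤ × ℤ) : ℕ :=
  {P : Fin p → List (ℤ × ℤ) | IsNonintFamily A S I P}.ncard

/-- The `p × p` matrix `Q`. -/
noncomputable def matrixQ {p r : ℕ} (A : Fin p → ℤ × ℤ) (I : Fin r → ℤ × ℤ) :
    Matrix (Fin p) (Fin p) ℤ :=
  Matrix.of fun i j => ∑ s : Fin r, ∑ t ∈ Finset.Ioi s,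
    ((pathCount (A i) (I s) : ℤ) * pathCount (A j) (I t) -
      (pathCount (A j) (I s) : ℤ) * pathCount (A i) (I t))

/-- The `p × q` matrix `H`. -/
noncomputable def matrixH {p q : ℕ} (A : Fin p → ℤ × ℤ) (S : Fin q → ℤ × ℤ) :
    Matrix (Fin p) (Fin q) ℤ :=
  Matrix.of fun i j => (pathCount (A i) (S j) : ℤ)

/-- The block matrix `(Q, H; -Hᵗ, 0)`, with rows and columns numbered consecutively (those of
the first block come first). -/
noncomputable def blockMatrix {p q r : ℕ} (A : Fin p → ℤ × ℤ) (S : Fin q → ℤ × ℤ)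
    (I : Fin r → ℤ × ℤ) : Matrix (Fin (p + q)) (Fin (p + q)) ℤ :=
  Matrix.reindex finSumFinEquiv finSumFinEquiv
    (Matrix.fromBlocks (matrixQ A I) (matrixH A S) (-(matrixH A S).transpose) 0)

/-- The sets that are counted by `pathCount` are finite. -/
theorem latticePath_finite (a e : ℤ × ℤ) : {l : List (ℤ × ℤ) | IsLatticePath a e l}.Finite := by
  suffices h : ∀ (n : ℕ) (a : ℤ × ℤ), (e.1 - a.1) + (e.2 - a.2) < n →
      {l : List (ℤ × ℤ) | IsLatticePath a e l}.Finite from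
    h ((e.1 - a.1) + (e.2 - a.2) + 1).toNat a (by omega)
  have hge : ∀ (l : List (ℤ × ℤ)) (a : ℤ × ℤ), IsLatticePath a e l →
      0 ≤ (e.1 - a.1) + (e.2 - a.2) := by
    intro l
    induction l with
    | nil => intro a h; simp [IsLatticePath] at h
    | cons x l ih =>
      intro a h
      cases l with
      | nil =>
        simp only [IsLatticePath, List.head?_cons, List.getLast?_singleton, Option.some.injEq] at h
        obtain ⟨rfl, rfl, -⟩ := h
        simp
      | cons y l =>
        obtain ⟨h1, h2, h3⟩ := h
        rw [List.isChain_cons_cons] at h3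
        have := ih y ⟨rfl, by simpa using h2, h3.2⟩
        simp only [List.head?_cons, Option.some.injEq] at h1
        subst h1
        rcases h3.1 with h | h <;> subst h <;> simp only at this <;> omega
  intro n
  induction n with
  | zero =>
    intro a ha
    refine Set.Finite.subset Set.finite_empty fun l hl => ?_
    have := hge l a hl
    omega
  | succ n ih =>
    intro a ha
    refine Set.Finite.subset ((Set.finite_singleton [a]).union
      (((ih (a.1 + 1, a.2) (by push_cast at ha ⊢; omega)).image (List.cons a)).union
        ((ih (a.1, a.2 + 1) (by push_cast at ha ⊢; omega)).image (List.cons a)))) ?_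
    rintro l ⟨h1, h2, h3⟩
    match l, h1, h2, h3 with
    | [x], h1, h2, h3 => left; simpa using h1
    | x :: y :: l, h1, h2, h3 =>
      right
      rw [List.isChain_cons_cons] at h3
      simp only [List.head?_cons, Option.some.injEq] at h1
      subst h1
      rcases h3.1 with h | h
      · left
        exact ⟨y :: l, ⟨by simp [h], by simpa using h2, h3.2⟩, rfl⟩
      · right
        exact ⟨y :: l, ⟨by simp [h], by simpa using h2, h3.2⟩, rfl⟩

/-- The sets that are counted by `nonintCount` are finite. -/
theorem nonintFamily_finite {p q r : ℕ} (A : Fin p → ℤ × ℤ) (S : Fin q → ℤ × ℤ)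
    (I : Fin r → ℤ × ℤ) : {P : Fin p → List (ℤ × ℤ) | IsNonintFamily A S I P}.Finite := by
  refine Set.Finite.subset (Set.Finite.pi' (t := fun k : Fin p =>
    (⋃ s : Fin q, {l | IsLatticePath (A k) (S s) l}) ∪
      ⋃ t : Fin r, {l | IsLatticePath (A k) (I t) l}) fun k =>
    (Set.finite_iUnion fun s => latticePath_finite _ _).union
      (Set.finite_iUnion fun t => latticePath_finite _ _)) ?_
  rintro P ⟨h1, ⟨j, -, h2⟩, -⟩ k
  by_cases hk : (k : ℕ) < q
  · obtain ⟨h, hP⟩ := h1 ⟨k, hk⟩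
    exact Or.inl (Set.mem_iUnion.2 ⟨⟨k, hk⟩, hP⟩)
  · exact Or.inr (Set.mem_iUnion.2 ⟨j ⟨k, not_lt.1 hk⟩, h2 ⟨k, not_lt.1 hk⟩⟩)

/-!
The proof is algebraic, apart from one cancellation of intersecting families of paths.

Write `E` for the list of end points `S 0, …, S (q-1), I 0, …, I (r-1)`. The block matrix has the
form `X B Xᵗ`, where the rows of `X` that belong to the starting points consist of the numbers
`pathCount (A i) (E k)`, and `B` is a skew-symmetric matrix of signs (`labelForm`). Since each index
occurs in exactly one pair of a perfect matching, the Pfaffian of such a matrix expands as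
`∑ f, (∏ i, X i (f i)) * Pf (B (f u) (f v))` (`pfaffian_mul_mul_transpose`), so that only the
Pfaffians `labelPfaffian f` of sign matrices have to be found, where `f` assigns an end point to
each starting point.

A Pfaffian is alternating (`pfaffian_submatrix_perm`). Therefore `labelPfaffian f` vanishes unless
`f` is injective, and `f = h ∘ π` with `h` increasing gives `sign π * labelPfaffian h`. It also
vanishes if one of the first `q` end points is not used. In the remaining case the matrix is a
standard one, whose Pfaffian `(-1) ^ q.choose 2` is found by expanding along the last row
(`pfaffian_expand_last`, `pfaffian_standardEntry`).

What is left is, for each `h`, the determinant of the numbers `pathCount (A i) (E (h k))` written as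
a sum over permutations. By the Lindström–Gessel–Viennot lemma (`sum_sign_prod_pathCount`) it is a
signed count of nonintersecting families, and the increasing `h` that use all of `S` are exactly the
lists of end points admitted in `nonintCount` (`nonintCount_eq_sum`).
-/

/-! ### The sign of a Pfaffian under a simultaneous permutation of rows and columns -/

theorem mem_perfectMatchings {m : ℕ} {σ : Equiv.Perm (Fin m)} :
    σ ∈ perfectMatchings m ↔ ∀ i, σ (σ i) = i ∧ σ i ≠ i := by
  simp [perfectMatchings]

/-- A crossing is determined by the smaller elements `a < b` of its two pairs. -/
theorem crossings_eq_card_pairs {m : ℕ} (σ : Equiv.Perm (Fin m)) :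
    crossings σ = (Finset.univ.filter fun x : Fin m × Fin m =>
      x.1 < x.2 ∧ x.2 < σ x.1 ∧ σ x.1 < σ x.2).card := by
  unfold crossings
  refine Finset.card_nbij' (fun x => (x.1, x.2.1)) (fun x => (x.1, x.2, σ x.1, σ x.2)) ?_ ?_ ?_ ?_
  · rintro ⟨a, b, c, d⟩ h
    simp only [Finset.coe_filter, Finset.mem_univ, true_and, Set.mem_ofPred_eq] at h ⊢
    obtain ⟨h1, h2, h3, rfl, rfl⟩ := h
    exact ⟨h1, h2, h3⟩
  · rintro ⟨a, b⟩ h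
    simpa using h
  · rintro ⟨a, b, c, d⟩ h
    simp only [Finset.coe_filter, Finset.mem_univ, true_and, Set.mem_ofPred_eq] at h ⊢
    obtain ⟨h1, h2, h3, rfl, rfl⟩ := h
    rfl
  · rintro ⟨a, b⟩ h
    rfl

theorem swap_adjacent_lt_iff {m : ℕ} {a b : Fin m} (hab : (b : ℕ) = a + 1) {x y : Fin m}
    (h1 : ¬(x = a ∧ y = b)) (h2 : ¬(x = b ∧ y = a)) :
    Equiv.swap a b x < Equiv.swap a b y ↔ x < y := by
  simp only [Equiv.swap_apply_def]
  split_ifs <;> simp only [Fin.lt_def, Fin.ext_iff] at * <;> omega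

theorem card_filter_add_odd {α : Type*} [Fintype α] [DecidableEq α] (P Q : α → Prop)
    [DecidablePred P] [DecidablePred Q] (z : α) (hz : P z ↔ ¬Q z) (h : ∀ x, x ≠ z → (P x ↔ Q x)) :
    Odd ((Finset.univ.filter P).card + (Finset.univ.filter Q).card) := by
  wlog hP : P z generalizing P Q
  · rw [add_comm]
    exact this Q P (by tauto) (fun x hx => (h x hx).symm) (by tauto)
  have : Finset.univ.filter P = insert z (Finset.univ.filter Q) := by
    ext x
    by_cases hx : x = z
    · subst hx; simp [hP]
    · simp [hx, h x hx]
  rw [this, Finset.card_insert_of_notMem (by simpa using hz.1 hP)]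
  exact ⟨_, by ring⟩

/-- Exchanging two adjacent points that are not paired with each other changes the parity of the
number of crossings: only the two pairs that contain these points can change whether they cross,
and they do. -/
theorem crossings_conj_swap_adjacent {m : ℕ} {σ : Equiv.Perm (Fin m)}
    (hσ : σ ∈ perfectMatchings m) {a b : Fin m} (hab : (b : ℕ) = a + 1) (h : σ a ≠ b) :
    Odd (crossings (Equiv.swap a b * σ * Equiv.swap a b) + crossings σ) := by
  rw [mem_perfectMatchings] at hσ
  set τ := Equiv.swap a b with hτ
  have e1 : crossings (τ * σ * τ) = (Finset.univ.filter fun x : Fin m × Fin m =>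
      τ x.1 < τ x.2 ∧ τ x.2 < τ (σ x.1) ∧ τ (σ x.1) < τ (σ x.2)).card := by
    rw [crossings_eq_card_pairs]
    refine Finset.card_equiv (τ.prodCongr τ) ?_
    rintro ⟨x, y⟩
    simp [hτ]
  rw [e1, crossings_eq_card_pairs]
  have inv : ∀ {x y}, σ x = y → σ y = x := by
    rintro x y rfl; exact (hσ x).1
  have hba : σ b ≠ a := fun h' => h (inv h')
  obtain ⟨X, hX⟩ : ∃ X, X = σ a := ⟨_, rfl⟩
  obtain ⟨Y, hY⟩ : ∃ Y, Y = σ b := ⟨_, rfl⟩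
  have hXa : X ≠ a := hX ▸ (hσ a).2
  have hYb : Y ≠ b := hY ▸ (hσ b).2
  have hXb : X ≠ b := hX ▸ h
  have hYa : Y ≠ a := hY ▸ hba
  have hab' : a ≠ b := by rintro rfl; omega
  have hXY : X ≠ Y := fun e => hab' (σ.injective (by rw [← hX, ← hY, e]))
  have τa : τ a = b := Equiv.swap_apply_left a b
  have τb : τ b = a := Equiv.swap_apply_right a b
  have τX : τ X = X := Equiv.swap_apply_of_ne_of_ne hXa hXb
  have τY : τ Y = Y := Equiv.swap_apply_of_ne_of_ne hYa hYb
  have σX : σ X = a := inv hX.symm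
  have σY : σ Y = b := inv hY.symm
  -- the only pairs of openers on which the two crossing conditions can differ
  have key : ∀ x y : Fin m, ¬ (x = a ∧ y = b) → ¬ (x = b ∧ y = a) → ¬ (x = X ∧ y = b) →
      ¬ (x = Y ∧ y = a) → ¬ (x = X ∧ y = Y) → ¬ (x = Y ∧ y = X) →
      ((τ x < τ y ∧ τ y < τ (σ x) ∧ τ (σ x) < τ (σ y)) ↔
        (x < y ∧ y < σ x ∧ σ x < σ y)) := by
    intro x y h1 h2 h3 h4 h5 h6
    rw [swap_adjacent_lt_iff hab h1 h2, swap_adjacent_lt_iff hab, swap_adjacent_lt_iff hab]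
    · rintro ⟨hx, hy⟩
      exact h5 ⟨by rw [hX, inv hx], by rw [hY, inv hy]⟩
    · rintro ⟨hx, hy⟩
      exact h6 ⟨by rw [hY, inv hx], by rw [hX, inv hy]⟩
    · rintro ⟨hx, hy⟩
      exact h4 ⟨by rw [hY, inv hy], hx⟩
    · rintro ⟨hx, hy⟩
      exact h3 ⟨by rw [hX, inv hy], hx⟩
  -- it suffices that on these six pairs the two conditions differ at exactly one pair `z`
  have fin : ∀ z : Fin m × Fin m,
      z = (a, b) ∨ z = (b, a) ∨ z = (X, b) ∨ z = (Y, a) ∨ z = (X, Y) ∨ z = (Y, X) →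
      (((b < a ∧ a < X ∧ X < Y) ↔ (a < b ∧ b < X ∧ X < Y ↔ (a, b) ≠ z)) ∧
      ((a < b ∧ b < Y ∧ Y < X) ↔ (b < a ∧ a < Y ∧ Y < X ↔ (b, a) ≠ z)) ∧
      ((X < a ∧ a < b ∧ b < Y) ↔ (X < b ∧ b < a ∧ a < Y ↔ (X, b) ≠ z)) ∧
      ((Y < b ∧ b < a ∧ a < X) ↔ (Y < a ∧ a < b ∧ b < X ↔ (Y, a) ≠ z)) ∧
      ((X < Y ∧ Y < b ∧ b < a) ↔ (X < Y ∧ Y < a ∧ a < b ↔ (X, Y) ≠ z)) ∧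
      ((Y < X ∧ X < a ∧ a < b) ↔ (Y < X ∧ X < b ∧ b < a ↔ (Y, X) ≠ z))) →
      Odd ((Finset.univ.filter fun x : Fin m × Fin m =>
        τ x.1 < τ x.2 ∧ τ x.2 < τ (σ x.1) ∧ τ (σ x.1) < τ (σ x.2)).card +
        (Finset.univ.filter fun x : Fin m × Fin m =>
          x.1 < x.2 ∧ x.2 < σ x.1 ∧ σ x.1 < σ x.2).card) := by
    rintro z hz ⟨h1, h2, h3, h4, h5, h6⟩
    have hw : ∀ w : Fin m × Fin m, w = (a, b) ∨ w = (b, a) ∨ w = (X, b) ∨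
        w = (Y, a) ∨ w = (X, Y) ∨ w = (Y, X) →
        ((τ w.1 < τ w.2 ∧ τ w.2 < τ (σ w.1) ∧ τ (σ w.1) < τ (σ w.2)) ↔
          (w.1 < w.2 ∧ w.2 < σ w.1 ∧ σ w.1 < σ w.2 ↔ w ≠ z)) := by
      rintro w (rfl | rfl | rfl | rfl | rfl | rfl) <;>
        simpa only [τa, τb, τX, τY, σX, σY, ← hX, ← hY]
    refine card_filter_add_odd _ _ z ((hw z hz).trans ⟨fun h hQ => h.1 hQ rfl,
      fun h => ⟨fun q => absurd q h, fun n => absurd rfl n⟩⟩) ?_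
    rintro ⟨x, y⟩ hne
    by_cases hx : (x, y) = (a, b) ∨ (x, y) = (b, a) ∨ (x, y) = (X, b) ∨
      (x, y) = (Y, a) ∨ (x, y) = (X, Y) ∨ (x, y) = (Y, X)
    · exact (hw (x, y) hx).trans (iff_true_right hne)
    · simp only [Prod.mk.injEq, not_or] at hx
      exact key x y hx.1 hx.2.1 hx.2.2.1 hx.2.2.2.1 hx.2.2.2.2.1 hx.2.2.2.2.2
  clear key e1 inv
  have val : ∀ {x y : Fin m}, x ≠ y → (x : ℕ) ≠ y := fun h => Fin.val_ne_of_ne h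
  have := val hXa
  have := val hXb
  have := val hYa
  have := val hYb
  have := val hXY
  by_cases hXlt : X < a <;> by_cases hYlt : Y < a <;> by_cases hlt : X < Y <;>
    simp only [Fin.lt_def] at hXlt hYlt hlt
  · exact fin (X, Y) (by simp) (by simp only [Fin.lt_def, ne_eq, Prod.mk.injEq, Fin.ext_iff]; grind)
  · exact fin (Y, X) (by simp) (by simp only [Fin.lt_def, ne_eq, Prod.mk.injEq, Fin.ext_iff]; grind)
  · exact fin (X, b) (by simp) (by simp only [Fin.lt_def, ne_eq, Prod.mk.injEq, Fin.ext_iff]; grind)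
  · omega
  · omega
  · exact fin (Y, a) (by simp) (by simp only [Fin.lt_def, ne_eq, Prod.mk.injEq, Fin.ext_iff]; grind)
  · exact fin (a, b) (by simp) (by simp only [Fin.lt_def, ne_eq, Prod.mk.injEq, Fin.ext_iff]; grind)
  · exact fin (b, a) (by simp) (by simp only [Fin.lt_def, ne_eq, Prod.mk.injEq, Fin.ext_iff]; grind)

/-- The term of a matching in a Pfaffian changes its sign under an adjacent transposition `(a b)`:
through the entry at `(a, b)` if `a` and `b` are paired, and through the crossings otherwise. -/
theorem prod_matching_swap_adjacent {R : Type*} [CommRing R] {m : ℕ}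
    {M : Matrix (Fin m) (Fin m) R} (hM : ∀ i j, M i j = -M j i) {σ : Equiv.Perm (Fin m)}
    (hσ : σ ∈ perfectMatchings m) {a b : Fin m} (hab : (b : ℕ) = a + 1) :
    (-1) ^ crossings (Equiv.swap a b * σ * Equiv.swap a b) *
        ∏ i ∈ Finset.univ.filter (fun i => Equiv.swap a b i < Equiv.swap a b (σ i)), M i (σ i) =
      -((-1) ^ crossings σ * ∏ i ∈ Finset.univ.filter (fun i => i < σ i), M i (σ i)) := by
  have hm := mem_perfectMatchings.1 hσ
  by_cases h : σ a = b
  · have hb : σ b = a := by rw [← h]; exact (hm a).1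
    have hlt : a < b := by rw [Fin.lt_def]; omega
    have hne : a ≠ b := hlt.ne
    have e : Equiv.swap a b * σ * Equiv.swap a b = σ := by
      rw [Equiv.swap_mul_eq_mul_swap]
      have : σ⁻¹ a = b ∧ σ⁻¹ b = a := by
        constructor <;> rw [Equiv.Perm.inv_eq_iff_eq] <;> simp [h, hb]
      rw [this.1, this.2, Equiv.swap_comm b a, mul_assoc, Equiv.swap_mul_self, mul_one]
    have f1 : Finset.univ.filter (fun i => i < σ i) =
        insert a (Finset.univ.filter fun i => i < σ i ∧ i ≠ a ∧ i ≠ b) := by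
      ext i
      by_cases ha : i = a
      · subst ha; simp [h, hlt]
      · by_cases hb' : i = b
        · subst hb'; simp [hb, hlt.not_gt, hne.symm]
        · simp [ha, hb']
    have f2 : Finset.univ.filter (fun i => Equiv.swap a b i < Equiv.swap a b (σ i)) =
        insert b (Finset.univ.filter fun i => i < σ i ∧ i ≠ a ∧ i ≠ b) := by
      ext i
      by_cases ha : i = a
      · subst ha; simp [h, hlt.not_gt, hne]
      · by_cases hb' : i = b
        · subst hb'; simp [hb, hlt]
        · have : Equiv.swap a b i < Equiv.swap a b (σ i) ↔ i < σ i :=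
            swap_adjacent_lt_iff hab (by tauto) (by tauto)
          simp [ha, hb', this]
    rw [e, f1, f2, Finset.prod_insert (by simp), Finset.prod_insert (by simp), h, hb, hM b a]
    ring
  · have f : Finset.univ.filter (fun i => Equiv.swap a b i < Equiv.swap a b (σ i)) =
        Finset.univ.filter fun i => i < σ i := by
      refine Finset.filter_congr fun i _ => swap_adjacent_lt_iff hab ?_ ?_
      · rintro ⟨rfl, h'⟩; exact h h'
      · rintro ⟨rfl, h'⟩; exact h (by rw [← h']; exact (hm _).1)
    have hodd := crossings_conj_swap_adjacent hσ hab h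
    have hs : (-1 : R) ^ crossings (Equiv.swap a b * σ * Equiv.swap a b) =
        -(-1) ^ crossings σ := by
      rcases Nat.even_or_odd (crossings σ) with h' | h'
      · rw [h'.neg_one_pow, ((Nat.odd_add.1 hodd).2 h').neg_one_pow]
      · rw [h'.neg_one_pow, ((Nat.odd_add'.1 hodd).1 h').neg_one_pow, neg_neg]
    rw [f, hs, neg_mul]

theorem pfaffian_submatrix_swap_adjacent {R : Type*} [CommRing R] {m : ℕ}
    {M : Matrix (Fin m) (Fin m) R} (hM : ∀ i j, M i j = -M j i) {a b : Fin m}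
    (hab : (b : ℕ) = a + 1) :
    pfaffian (M.submatrix (Equiv.swap a b) (Equiv.swap a b)) = -pfaffian M := by
  set τ := Equiv.swap a b with hτ
  have hττ : ∀ x, τ (τ x) = x := fun x => Equiv.swap_apply_self a b x
  have hconj : ∀ σ, τ * (τ * σ * τ) * τ = σ := fun σ => by ext; simp [hττ]
  have hmem : ∀ σ ∈ perfectMatchings m, τ * σ * τ ∈ perfectMatchings m := by
    intro σ hσ
    rw [mem_perfectMatchings] at hσ ⊢
    intro i
    refine ⟨by simp [hττ, (hσ _).1], fun h => (hσ (τ i)).2 (τ.injective ?_)⟩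
    simpa [hττ] using h
  unfold pfaffian
  rw [← Finset.sum_neg_distrib]
  refine Finset.sum_nbij' (fun σ => τ * σ * τ) (fun σ => τ * σ * τ) hmem hmem
    (fun σ _ => hconj σ) (fun σ _ => hconj σ) ?_
  · intro σ hσ
    rw [← prod_matching_swap_adjacent hM (hmem σ hσ) hab, ← hτ, hconj]
    congr 1
    refine Finset.prod_equiv τ (fun i => ?_) (fun i _ => ?_)
    · simp [hττ]
    · simp [hττ]

/-- The Pfaffian of a skew-symmetric matrix is alternating: permuting its rows and columns
simultaneously multiplies it by the sign of the permutation. -/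
theorem pfaffian_submatrix_perm {R : Type*} [CommRing R] {m : ℕ}
    {M : Matrix (Fin m) (Fin m) R} (hM : ∀ i j, M i j = -M j i) (π : Equiv.Perm (Fin m)) :
    pfaffian (M.submatrix π π) = ((Equiv.Perm.sign π : ℤ) : R) * pfaffian M := by
  cases m with
  | zero => simp [Subsingleton.elim π 1]
  | succ n =>
    have hπ : π ∈ Submonoid.closure
        (Set.range fun i : Fin n => Equiv.swap i.castSucc i.succ) := by
      rw [Equiv.Perm.mclosure_swap_castSucc_succ]; trivial
    induction hπ using Submonoid.closure_induction generalizing M with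
    | mem x hx =>
      obtain ⟨i, rfl⟩ := hx
      dsimp only
      rw [pfaffian_submatrix_swap_adjacent hM (by simp),
        Equiv.Perm.sign_swap (Fin.castSucc_lt_succ).ne]
      simp
    | one => simp
    | mul x y _ _ hx hy =>
      have : M.submatrix ⇑(x * y) ⇑(x * y) = (M.submatrix x x).submatrix y y := rfl
      rw [this, hy (M := M.submatrix x x) fun i j => hM _ _, hx hM, Equiv.Perm.sign_mul]
      push_cast
      ring

/-! ### Expansion of a Pfaffian along its last row -/

/-- The matching of `Fin (m + 2)` that pairs `i` with the last point and matches the other points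
in the way `σ` matches `Fin m`. -/
def addLastPair {m : ℕ} (i : Fin (m + 1)) (σ : Equiv.Perm (Fin m)) : Equiv.Perm (Fin (m + 2)) :=
  (finSuccEquivLast.trans (finSuccEquiv' i).optionCongr).symm.permCongr
    (Equiv.swap none (some none) * σ.optionCongr.optionCongr)

section addLastPair

variable {m : ℕ} (i : Fin (m + 1)) (σ : Equiv.Perm (Fin m))

@[simp] theorem addLastPair_last : addLastPair i σ (Fin.last (m + 1)) = i.castSucc := by
  simp [addLastPair, ← Equiv.optionCongr_symm]

@[simp] theorem addLastPair_castSucc : addLastPair i σ i.castSucc = Fin.last (m + 1) := by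
  simp [addLastPair, ← Equiv.optionCongr_symm]

@[simp] theorem addLastPair_succAbove (k : Fin m) :
    addLastPair i σ (i.succAbove k).castSucc = (i.succAbove (σ k)).castSucc := by
  simp [addLastPair, ← Equiv.optionCongr_symm, Equiv.swap_apply_of_ne_of_ne]

theorem forall_fin_add_two {P : Fin (m + 2) → Prop} :
    (∀ x, P x) ↔ P (Fin.last (m + 1)) ∧ P i.castSucc ∧ ∀ k, P (i.succAbove k).castSucc := by
  rw [Fin.forall_fin_succ', Fin.forall_iff_succAbove i]
  tauto

theorem addLastPair_mem {σ : Equiv.Perm (Fin m)} (hσ : σ ∈ perfectMatchings m) :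
    addLastPair i σ ∈ perfectMatchings (m + 2) := by
  rw [mem_perfectMatchings] at hσ ⊢
  rw [forall_fin_add_two i]
  simp [hσ, Fin.castSucc_ne_last, (Fin.castSucc_ne_last _).symm]

theorem addLastPair_injective : Function.Injective (addLastPair i) := by
  intro σ τ h
  refine Equiv.ext fun k => ?_
  have := congrArg (fun π => π (i.succAbove k).castSucc) h
  simpa using this

theorem exists_addLastPair {σ : Equiv.Perm (Fin (m + 2))} (hσ : σ ∈ perfectMatchings (m + 2))
    (hi : σ (Fin.last (m + 1)) = i.castSucc) :
    ∃ τ ∈ perfectMatchings m, addLastPair i τ = σ := by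
  have hm := mem_perfectMatchings.1 hσ
  have hi' : σ i.castSucc = Fin.last (m + 1) := by rw [← hi]; exact (hm _).1
  have h : ∀ k : Fin m, ∃ l : Fin m,
      σ (i.succAbove k).castSucc = (i.succAbove l).castSucc := by
    intro k
    obtain ⟨x, hx⟩ := Fin.exists_castSucc_eq.2
      (show σ (i.succAbove k).castSucc ≠ Fin.last (m + 1) by
        rw [← hi', σ.injective.ne_iff]; simp)
    have hxi : x ≠ i := by
      rintro rfl
      rw [← hi, σ.injective.eq_iff] at hx
      exact Fin.castSucc_ne_last _ hx.symm
    obtain ⟨l, rfl⟩ := Fin.exists_succAbove_eq hxi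
    exact ⟨l, hx.symm⟩
  choose g hg using h
  have hg2 : Function.Involutive g := by
    intro k
    have := (hm (i.succAbove k).castSucc).1
    rw [hg, hg] at this
    simpa using this
  refine ⟨hg2.toPerm g, ?_, ?_⟩
  · rw [mem_perfectMatchings]
    intro k
    refine ⟨hg2 k, fun h => (hm (i.succAbove k).castSucc).2 ?_⟩
    have h : g k = k := h
    rw [hg, h]
  · rw [Equiv.ext_iff, forall_fin_add_two i]
    refine ⟨by simp [hi], by simp [hi'], fun k => by simp [hg]⟩

theorem prod_addLastPair {R : Type*} [CommRing R] (M : Matrix (Fin (m + 2)) (Fin (m + 2)) R) :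
    ∏ x ∈ Finset.univ.filter (fun x => x < addLastPair i σ x), M x (addLastPair i σ x) =
      M i.castSucc (Fin.last (m + 1)) * ∏ k ∈ Finset.univ.filter (fun k => k < σ k),
        M (i.succAbove k).castSucc (i.succAbove (σ k)).castSucc := by
  simp only [Finset.prod_filter]
  rw [Fin.prod_univ_castSucc, Fin.prod_univ_succAbove _ i]
  simp [Fin.castSucc_lt_last, (Fin.castSucc_lt_last _).not_gt]

/-- The number of points below `i` that a fixed-point-free involution sends to points above is
congruent modulo 2 to the number of all points below `i`: the remaining ones are matched in pairs. -/
theorem even_card_crossed_add {σ : Equiv.Perm (Fin m)} (hσ : σ ∈ perfectMatchings m) :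
    Even ((Finset.univ.filter fun k : Fin m => (k : ℕ) < i ∧ (i : ℕ) ≤ σ k).card + i) := by
  rw [mem_perfectMatchings] at hσ
  have h1 : (Finset.univ.filter fun k : Fin m => (k : ℕ) < i).card = i := by
    rw [Fin.card_filter_val_lt]; omega
  have h2 := Finset.card_filter_add_card_filter_not
    (s := Finset.univ.filter fun k : Fin m => (k : ℕ) < i) (fun k => (i : ℕ) ≤ σ k)
  rw [h1, Finset.filter_filter, Finset.filter_filter] at h2
  have h3 : Even (Finset.univ.filter fun k : Fin m => (k : ℕ) < i ∧ ¬ (i : ℕ) ≤ σ k).card := by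
    rw [← ZMod.natCast_eq_zero_iff_even, Finset.cast_card]
    refine Finset.sum_involution (fun k _ => σ k) ?_ ?_ ?_ ?_
    · intro k _; decide
    · intro k _ _; exact (hσ k).2
    · intro k hk
      simp only [Finset.mem_filter, Finset.mem_univ, true_and, (hσ k).1] at hk ⊢
      omega
    · intro k _; exact (hσ k).1
  obtain ⟨c, hc⟩ := h3
  exact ⟨(Finset.univ.filter fun k : Fin m => (k : ℕ) < i ∧ (i : ℕ) ≤ σ k).card + c, by omega⟩

/-- The new pair crosses the pairs with one point on either side of `i`. -/
theorem crossings_addLastPair :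
    crossings (addLastPair i σ) =
      crossings σ + (Finset.univ.filter fun k : Fin m => (k : ℕ) < i ∧ (i : ℕ) ≤ σ k).card := by
  have hlt : ∀ k : Fin m, i.succAbove k < i ↔ (k : ℕ) < i := by
    intro k; rw [Fin.succAbove_lt_iff_castSucc_lt, Fin.lt_def]; rfl
  have hgt : ∀ k : Fin m, i < i.succAbove k ↔ (i : ℕ) ≤ k := by
    intro k; rw [Fin.lt_succAbove_iff_le_castSucc, Fin.le_def]; rfl
  simp only [crossings_eq_card_pairs, Finset.card_filter, Fintype.sum_prod_type]
  rw [Fin.sum_univ_castSucc, Fin.sum_univ_succAbove _ i]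
  simp only [Fin.sum_univ_castSucc, Fin.sum_univ_succAbove _ i]
  simp [Fin.castSucc_lt_last, (Fin.castSucc_lt_last _).not_gt, hlt, hgt, Finset.sum_add_distrib]
  ring

end addLastPair

theorem pfaffian_expand_last {R : Type*} [CommRing R] {m : ℕ}
    (M : Matrix (Fin (m + 2)) (Fin (m + 2)) R) :
    pfaffian M = ∑ i : Fin (m + 1), (-1) ^ (i : ℕ) * M i.castSucc (Fin.last (m + 1)) *
      pfaffian (M.submatrix (fun k => (i.succAbove k).castSucc)
        fun k => (i.succAbove k).castSucc) := by
  conv_lhs => unfold pfaffian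
  rw [← Finset.sum_fiberwise (perfectMatchings (m + 2)) (fun σ => σ (Fin.last (m + 1))),
    Fin.sum_univ_castSucc]
  have h0 : (perfectMatchings (m + 2)).filter
      (fun σ => σ (Fin.last (m + 1)) = Fin.last (m + 1)) = ∅ := by
    refine Finset.filter_eq_empty_iff.2 fun σ hσ => (mem_perfectMatchings.1 hσ _).2
  rw [h0, Finset.sum_empty, add_zero]
  refine Finset.sum_congr rfl fun i _ => ?_
  rw [pfaffian, Finset.mul_sum]
  symm
  refine Finset.sum_nbij (addLastPair i) ?_ (addLastPair_injective i).injOn ?_ ?_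
  · intro σ hσ
    simp [addLastPair_mem i hσ]
  · intro σ hσ
    simp only [Finset.coe_filter, Set.mem_ofPred_eq] at hσ
    exact exists_addLastPair i hσ.1 hσ.2
  · intro σ hσ
    have hs : (-1 : R) ^ (Finset.univ.filter fun k : Fin m => (k : ℕ) < i ∧ (i : ℕ) ≤ σ k).card
        = (-1) ^ (i : ℕ) := by
      have := even_card_crossed_add i hσ
      rw [Nat.even_add] at this
      rcases Nat.even_or_odd (i : ℕ) with h | h
      · rw [h.neg_one_pow, (this.2 h).neg_one_pow]
      · rw [h.neg_one_pow, Odd.neg_one_pow]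
        rw [← Nat.not_even_iff_odd] at h ⊢
        tauto
    rw [prod_addLastPair, crossings_addLastPair, pow_add, hs]
    simp only [Matrix.submatrix_apply]
    ring

/-! ### Pfaffians of standard matrices of zeros and ones -/

/-- Entries above the diagonal of the matrix in which the `q` first points are joined to the
`q` last points, in order, and the `n` points in between are joined to each other. -/
def standardEntry (q n i j : ℕ) : ℤ :=
  if (q ≤ i ∧ j < q + n) ∨ (i < q ∧ j = i + q + n) then 1 else 0

/-- A Pfaffian depends only on the entries above the diagonal. -/
theorem pfaffian_congr {R : Type*} [CommRing R] {m : ℕ} {M N : Matrix (Fin m) (Fin m) R}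
    (h : ∀ i j, i < j → M i j = N i j) : pfaffian M = pfaffian N := by
  unfold pfaffian
  refine Finset.sum_congr rfl fun σ _ => congrArg _ (Finset.prod_congr rfl fun i hi => ?_)
  exact h _ _ (Finset.mem_filter.1 hi).2

theorem pfaffian_fin_zero {R : Type*} [CommRing R] (M : Matrix (Fin 0) (Fin 0) R) :
    pfaffian M = 1 := by
  have h : perfectMatchings 0 = {1} := by
    ext σ; simp [mem_perfectMatchings, Subsingleton.elim σ 1]
  simp [pfaffian, h, crossings_eq_card_pairs]

theorem pfaffian_one_above_diagonal (n : ℕ) :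
    pfaffian (Matrix.of fun _ _ : Fin (2 * n) => (1 : ℤ)) = 1 := by
  induction n with
  | zero => exact pfaffian_fin_zero (R := ℤ) (Matrix.of fun _ _ => 1)
  | succ n ih =>
    have h : pfaffian (R := ℤ) (Matrix.of fun _ _ : Fin (2 * n + 2) => (1 : ℤ)) =
        ∑ i : Fin (2 * n + 1), (-1) ^ (i : ℕ) * 1 *
          pfaffian (Matrix.of fun _ _ : Fin (2 * n) => (1 : ℤ)) := pfaffian_expand_last _
    rw [show 2 * (n + 1) = 2 * n + 2 by ring, h, ih]
    rw [Fin.sum_univ_eq_sum_range (fun i => (-1 : ℤ) ^ i * 1 * 1) (2 * n + 1)]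
    simp [Finset.sum_range_succ, neg_one_geom_sum]

theorem pfaffian_standardEntry (q n m : ℕ) (hm : m = 2 * n + 2 * q) :
    pfaffian (Matrix.of fun i j : Fin m => standardEntry q (2 * n) i j) =
      (-1) ^ q.choose 2 := by
  induction q generalizing m with
  | zero =>
    subst hm
    rw [Nat.choose_zero_succ, pow_zero]
    refine (pfaffian_congr fun i j _ => ?_).trans (pfaffian_one_above_diagonal n)
    simp [standardEntry]
  | succ q ih =>
    obtain rfl : m = (2 * n + 2 * q) + 2 := by omega
    rw [pfaffian_expand_last, Finset.sum_eq_single (⟨q, by omega⟩ : Fin (2 * n + 2 * q + 1))]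
    · have h : pfaffian ((Matrix.of fun i j : Fin (2 * n + 2 * q + 2) =>
          standardEntry (q + 1) (2 * n) i j).submatrix
          (fun k => (Fin.succAbove ⟨q, by omega⟩ k).castSucc)
          (fun k => (Fin.succAbove ⟨q, by omega⟩ k).castSucc)) = (-1) ^ q.choose 2 := by
        rw [← ih _ rfl]
        refine pfaffian_congr fun i j hij => ?_
        simp only [Matrix.submatrix_apply, Matrix.of_apply, Fin.succAbove, Fin.lt_def] at hij ⊢
        unfold standardEntry
        split_ifs <;> simp_all <;> omega
      rw [h]
      simp only [Matrix.of_apply, standardEntry, Nat.choose_succ_succ' q 1]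
      rw [if_pos (by right; simp; omega)]
      simp [pow_add]
    · intro i _ hi
      have : standardEntry (q + 1) (2 * n) i (2 * n + 2 * q + 1) = 0 := by
        rw [standardEntry, if_neg]
        rw [ne_eq, Fin.ext_iff] at hi
        dsimp only at hi
        omega
      simp [this]
    · simp

/-! ### The minor summation expansion of a Pfaffian -/

/-- A function on `Fin m` is the same as a pair of values for each pair of a matching. -/
def matchingFunEquiv {m : ℕ} {σ : Equiv.Perm (Fin m)} (hσ : σ ∈ perfectMatchings m) (L : Type*) :
    (Fin m → L) ≃ ({u : Fin m // u < σ u} → L × L) where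
  toFun f u := (f u, f (σ u))
  invFun g u := if h : u < σ u then (g ⟨u, h⟩).1 else
    (g ⟨σ u, by
      have := mem_perfectMatchings.1 hσ u
      rw [this.1]
      exact lt_of_le_of_ne (not_lt.1 h) this.2⟩).2
  left_inv f := by
    funext u
    have := mem_perfectMatchings.1 hσ u
    dsimp only
    split_ifs
    · rfl
    · rw [this.1]
  right_inv g := by
    funext u
    have := mem_perfectMatchings.1 hσ u
    have hu := u.2
    ext
    · simp [hu]
    · simp [this.1, hu.not_gt]

theorem prod_eq_prod_matching {R : Type*} [CommRing R] {m : ℕ} {σ : Equiv.Perm (Fin m)}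
    (hσ : σ ∈ perfectMatchings m) (F : Fin m → R) :
    ∏ u, F u = ∏ u : {u : Fin m // u < σ u}, F u * F (σ u) := by
  have hm := mem_perfectMatchings.1 hσ
  rw [Finset.prod_mul_distrib,
    ← Finset.prod_subtype (Finset.univ.filter fun u => u < σ u) (by simp) F,
    ← Finset.prod_subtype (Finset.univ.filter fun u => u < σ u) (by simp) (fun u => F (σ u)),
    ← Finset.prod_filter_mul_prod_filter_not Finset.univ (fun u => u < σ u)]
  congr 1
  refine Finset.prod_equiv σ (fun u => ?_) (fun u _ => by rw [(hm u).1])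
  have := hm u
  simp only [Finset.mem_filter, Finset.mem_univ, true_and, this.1, not_lt]
  exact ⟨fun h => lt_of_le_of_ne h this.2, le_of_lt⟩

/-- A Pfaffian of the form `Pf (X B Xᵗ)` is the sum, over all choices of a column of `X` for each
row, of the product of the chosen entries with the Pfaffian of the chosen entries of `B`. -/
theorem pfaffian_mul_mul_transpose {R L : Type*} [CommRing R] [Fintype L] {m : ℕ}
    (X : Fin m → L → R) (B : L → L → R) :
    pfaffian (Matrix.of fun u v => ∑ k, ∑ l, X u k * B k l * X v l) =
      ∑ f : Fin m → L, (∏ u, X u (f u)) * pfaffian (Matrix.of fun u v => B (f u) (f v)) := by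
  classical
  unfold pfaffian
  simp only [Finset.mul_sum]
  rw [Finset.sum_comm]
  refine Finset.sum_congr rfl fun σ hσ => ?_
  simp only [mul_left_comm _ ((-1 : R) ^ crossings σ), ← Finset.mul_sum]
  congr 1
  rw [Finset.prod_subtype (p := fun u => u < σ u) _ (by simp)]
  simp only [Matrix.of_apply, ← Fintype.sum_prod_type']
  rw [Fintype.prod_sum]
  symm
  refine Fintype.sum_equiv (matchingFunEquiv hσ L) _ _ fun f => ?_
  rw [prod_eq_prod_matching hσ, Finset.prod_subtype (p := fun u => u < σ u) _ (by simp),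
    ← Finset.prod_mul_distrib]
  refine Finset.prod_congr rfl fun u _ => ?_
  simp only [matchingFunEquiv, Equiv.coe_fn_mk]
  ring

/-! ### Cancellation of intersecting families of lattice paths -/

/-- The list that follows `l'` up to the first visit of `v` and then `l`, from its first visit of
`v` on. -/
def splice {α : Type*} [DecidableEq α] (v : α) (l' l : List α) : List α :=
  l'.takeWhile (· ≠ v) ++ l.dropWhile (· ≠ v)

section splice

variable {α : Type*} [DecidableEq α] (v : α)

theorem splice_self (l : List α) : splice v l l = l :=
  List.takeWhile_append_dropWhile

theorem takeWhile_splice (l' l : List α) :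
    (splice v l' l).takeWhile (· ≠ v) = l'.takeWhile (· ≠ v) := by
  rw [splice, List.takeWhile_append_of_pos]
  · have : (l.dropWhile (· ≠ v)).takeWhile (· ≠ v) = [] := by
      rw [List.takeWhile_eq_nil_iff]
      intro h
      have := List.dropWhile_get_zero_not (p := (· ≠ v)) l h
      simpa using this
    rw [this, List.append_nil]
  · intro x hx
    exact List.mem_takeWhile_imp (p := fun x => decide (x ≠ v)) hx

theorem dropWhile_splice (l' l : List α) :
    (splice v l' l).dropWhile (· ≠ v) = l.dropWhile (· ≠ v) := by
  rw [splice, List.dropWhile_append_of_pos, List.dropWhile_idempotent]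
  intro x hx
  exact List.mem_takeWhile_imp (p := fun x => decide (x ≠ v)) hx

theorem splice_splice (a b c d : List α) :
    splice v (splice v a b) (splice v c d) = splice v a d := by
  conv_lhs => rw [splice, takeWhile_splice, dropWhile_splice]
  rfl

theorem mem_splice_iff (l' l : List α) : v ∈ splice v l' l ↔ v ∈ l := by
  have h : ∀ l : List α, v ∉ l.takeWhile (· ≠ v) := fun l h => by
    simpa using List.mem_takeWhile_imp h
  rw [splice, List.mem_append, or_iff_right (h l')]
  conv_rhs => rw [← List.takeWhile_append_dropWhile (p := (· ≠ v)) (l := l), List.mem_append,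
    or_iff_right (h l)]

theorem splice_append_cons {s s' t t' : List α} (hs : v ∉ s) (hs' : v ∉ s') :
    splice v (s' ++ v :: t') (s ++ v :: t) = s' ++ v :: t := by
  have h : ∀ s : List α, v ∉ s → ∀ x ∈ s, decide (x ≠ v) = true := fun s hs x hx => by
    simpa using fun e : x = v => hs (e ▸ hx)
  rw [splice, List.takeWhile_append_of_pos (h s' hs'), List.dropWhile_append_of_pos (h s hs)]
  simp

end splice

theorem IsLatticePath.splice {a a' e e' v : ℤ × ℤ} {l l' : List (ℤ × ℤ)}
    (h : IsLatticePath a e l) (h' : IsLatticePath a' e' l') (hv : v ∈ l) (hv' : v ∈ l') :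
    IsLatticePath a' e (splice v l' l) := by
  obtain ⟨s, t, rfl, hs⟩ := List.eq_append_cons_of_mem hv
  obtain ⟨s', t', rfl, hs'⟩ := List.eq_append_cons_of_mem hv'
  rw [splice_append_cons v hs hs']
  obtain ⟨-, h2, h3⟩ := h
  obtain ⟨h1', -, h3'⟩ := h'
  refine ⟨?_, ?_, ?_⟩
  · cases s' <;> simpa using h1'
  · simpa using h2
  · rw [List.isChain_split] at h3 h3' ⊢
    exact ⟨h3'.1, h3.2⟩

theorem IsLatticePath.nodup {a e : ℤ × ℤ} {l : List (ℤ × ℤ)} (h : IsLatticePath a e l) :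
    l.Nodup := by
  have h1 : l.IsChain fun u v : ℤ × ℤ => u.1 + u.2 < v.1 + v.2 := by
    refine h.2.2.imp fun u v huv => ?_
    rcases huv with rfl | rfl <;> dsimp only <;> omega
  have : IsTrans (ℤ × ℤ) fun u v => u.1 + u.2 < v.1 + v.2 := ⟨fun _ _ _ => lt_trans⟩
  refine (List.isChain_iff_pairwise.1 h1).imp fun huv => ?_
  rintro rfl
  exact lt_irrefl _ huv

/-- The multiset of all vertices of a family of paths. -/
def vertexMultiset {p : ℕ} (P : Fin p → List (ℤ × ℤ)) : Multiset (ℤ × ℤ) :=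
  ∑ k, (P k : Multiset (ℤ × ℤ))

/-- The members of a family of paths that contain a given vertex. -/
def pathsThrough {p : ℕ} (P : Fin p → List (ℤ × ℤ)) (v : ℤ × ℤ) : Finset (Fin p) :=
  Finset.univ.filter fun k => v ∈ P k

theorem count_vertexMultiset {p : ℕ} {P : Fin p → List (ℤ × ℤ)} (hP : ∀ k, (P k).Nodup)
    (v : ℤ × ℤ) : (vertexMultiset P).count v = (pathsThrough P v).card := by
  rw [vertexMultiset, Multiset.count_sum', pathsThrough, Finset.card_filter]
  refine Finset.sum_congr rfl fun k _ => ?_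
  rw [Multiset.count_eq_of_nodup (Multiset.coe_nodup.2 (hP k))]
  simp only [Multiset.mem_coe]

theorem nodup_vertexMultiset_iff {p : ℕ} {P : Fin p → List (ℤ × ℤ)} (hP : ∀ k, (P k).Nodup) :
    (vertexMultiset P).Nodup ↔ Pairwise fun k l => (P k).Disjoint (P l) := by
  simp only [Multiset.nodup_iff_count_le_one, count_vertexMultiset hP, Finset.card_le_one,
    pathsThrough, Finset.mem_filter, Finset.mem_univ, true_and]
  constructor
  · intro h k l hkl v hk hl
    exact hkl (h v k hk l hl)
  · intro h v k hk l hl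
    by_contra hkl
    exact h hkl hk hl

/-- A vertex that occurs more than once in a multiset, if there is one. -/
noncomputable def repeatedVertex (W : Multiset (ℤ × ℤ)) : ℤ × ℤ :=
  Classical.epsilon fun v => 1 < W.count v

theorem one_lt_count_repeatedVertex {W : Multiset (ℤ × ℤ)} (hW : ¬W.Nodup) :
    1 < W.count (repeatedVertex W) := by
  rw [Multiset.nodup_iff_count_le_one] at hW
  push Not at hW
  exact Classical.epsilon_spec hW

/-- The transposition of two distinct elements of a finite set, if there are any. -/
noncomputable def someSwap {p : ℕ} (K : Finset (Fin p)) : Equiv.Perm (Fin p) :=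
  Classical.epsilon fun τ => ∃ i ∈ K, ∃ j ∈ K, i ≠ j ∧ τ = Equiv.swap i j

theorem someSwap_spec {p : ℕ} {K : Finset (Fin p)} (hK : 1 < K.card) :
    ∃ i ∈ K, ∃ j ∈ K, i ≠ j ∧ someSwap K = Equiv.swap i j := by
  refine Classical.epsilon_spec (p := fun τ => ∃ i ∈ K, ∃ j ∈ K, i ≠ j ∧ τ = Equiv.swap i j) ?_
  obtain ⟨i, hi, j, hj, hij⟩ := Finset.one_lt_card.1 hK
  exact ⟨_, i, hi, j, hj, hij, rfl⟩

/-- The transposition by which the initial segments of an intersecting family are exchanged. It is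
determined by the multiset of all vertices and by the set of paths through the vertex chosen
there, both of which the exchange leaves unchanged. -/
noncomputable def intersectionSwap {p : ℕ} (P : Fin p → List (ℤ × ℤ)) : Equiv.Perm (Fin p) :=
  someSwap (pathsThrough P (repeatedVertex (vertexMultiset P)))

/-- Exchange of the initial segments of two intersecting paths of a family. -/
noncomputable def spliceFamily {p : ℕ} (P : Fin p → List (ℤ × ℤ)) : Fin p → List (ℤ × ℤ) :=
  fun k => splice (repeatedVertex (vertexMultiset P)) (P (intersectionSwap P k)) (P k)

theorem vertexMultiset_spliceFamily {p : ℕ} (P : Fin p → List (ℤ × ℤ)) :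
    vertexMultiset (spliceFamily P) = vertexMultiset P := by
  set v := repeatedVertex (vertexMultiset P) with hv
  have h : ∀ k, (spliceFamily P k : Multiset (ℤ × ℤ)) =
      ((P (intersectionSwap P k)).takeWhile (· ≠ v) : Multiset (ℤ × ℤ)) +
        ((P k).dropWhile (· ≠ v) : Multiset (ℤ × ℤ)) := fun k => by
    rw [Multiset.coe_add]; rfl
  rw [vertexMultiset, Finset.sum_congr rfl fun k _ => h k, Finset.sum_add_distrib,
    Equiv.sum_comp (intersectionSwap P) fun k => ((P k).takeWhile (· ≠ v) : Multiset (ℤ × ℤ)),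
    ← Finset.sum_add_distrib]
  refine Finset.sum_congr rfl fun k _ => ?_
  rw [Multiset.coe_add, List.takeWhile_append_dropWhile]

theorem intersectionSwap_spliceFamily {p : ℕ} (P : Fin p → List (ℤ × ℤ)) :
    intersectionSwap (spliceFamily P) = intersectionSwap P := by
  rw [intersectionSwap, intersectionSwap, vertexMultiset_spliceFamily]
  congr 1
  ext k
  simp only [pathsThrough, Finset.mem_filter, Finset.mem_univ, true_and, spliceFamily,
    mem_splice_iff]

theorem intersectionSwap_spec {p : ℕ} {P : Fin p → List (ℤ × ℤ)} (hP : ∀ k, (P k).Nodup)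
    (h : ¬(vertexMultiset P).Nodup) : ∃ i j, i ≠ j ∧ intersectionSwap P = Equiv.swap i j ∧
      repeatedVertex (vertexMultiset P) ∈ P i ∧ repeatedVertex (vertexMultiset P) ∈ P j := by
  have h1 := one_lt_count_repeatedVertex h
  rw [count_vertexMultiset hP] at h1
  obtain ⟨i, hi, j, hj, hij, e⟩ := someSwap_spec h1
  exact ⟨i, j, hij, e, (Finset.mem_filter.1 hi).2, (Finset.mem_filter.1 hj).2⟩

theorem spliceFamily_spliceFamily {p : ℕ} {P : Fin p → List (ℤ × ℤ)} (hP : ∀ k, (P k).Nodup)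
    (h : ¬(vertexMultiset P).Nodup) : spliceFamily (spliceFamily P) = P := by
  obtain ⟨i, j, -, e, -⟩ := intersectionSwap_spec hP h
  funext k
  rw [spliceFamily, intersectionSwap_spliceFamily, vertexMultiset_spliceFamily, spliceFamily,
    spliceFamily, splice_splice, e, Equiv.swap_apply_self, splice_self]

theorem isLatticePath_spliceFamily {p : ℕ} {A E : Fin p → ℤ × ℤ} {P : Fin p → List (ℤ × ℤ)}
    (hP : ∀ k, IsLatticePath (A k) (E k) (P k)) (h : ¬(vertexMultiset P).Nodup) (k : Fin p) :
    IsLatticePath (A (intersectionSwap P k)) (E k) (spliceFamily P k) := by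
  obtain ⟨i, j, hij, e, hi, hj⟩ := intersectionSwap_spec (fun k => (hP k).nodup) h
  rw [spliceFamily]
  by_cases hk : intersectionSwap P k = k
  · rw [hk, splice_self]
    exact hP k
  · rw [e] at hk ⊢
    rcases (Equiv.swap_apply_ne_self_iff.1 hk).2 with rfl | rfl
    · rw [Equiv.swap_apply_left]
      exact (hP _).splice (hP _) hi hj
    · rw [Equiv.swap_apply_right]
      exact (hP _).splice (hP _) hj hi

/-- The finite set of lattice paths between two points. -/
noncomputable def latticePaths (a e : ℤ × ℤ) : Finset (List (ℤ × ℤ)) :=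
  (latticePath_finite a e).toFinset

theorem mem_latticePaths {a e : ℤ × ℤ} {l : List (ℤ × ℤ)} :
    l ∈ latticePaths a e ↔ IsLatticePath a e l := by
  simp [latticePaths]

theorem pathCount_eq_card (a e : ℤ × ℤ) : pathCount a e = (latticePaths a e).card :=
  Set.ncard_eq_toFinset_card _ _

/-- The number of nonintersecting families of lattice paths with prescribed ends. -/
noncomputable def disjointCount {p : ℕ} (A E : Fin p → ℤ × ℤ) : ℕ :=
  {P : Fin p → List (ℤ × ℤ) | (∀ k, IsLatticePath (A k) (E k) (P k)) ∧
    Pairwise fun k l => (P k).Disjoint (P l)}.ncard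

theorem disjointCount_eq_card {p : ℕ} (A E : Fin p → ℤ × ℤ) :
    disjointCount A E = ((Fintype.piFinset fun k => latticePaths (A k) (E k)).filter
      fun P => (vertexMultiset P).Nodup).card := by
  rw [disjointCount, ← Set.ncard_coe_finset]
  congr 1
  ext P
  simp only [Set.mem_ofPred_eq, Finset.coe_filter, Fintype.mem_piFinset, mem_latticePaths]
  exact and_congr_right fun h => (nodup_vertexMultiset_iff fun k => (h k).nodup).symm

theorem sum_sign_intersecting_eq_zero {p : ℕ} (A E : Fin p → ℤ × ℤ) :
    ∑ π : Equiv.Perm (Fin p), (Equiv.Perm.sign π : ℤ) *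
      (((Fintype.piFinset fun k => latticePaths (A (π k)) (E k)).filter
        fun P => ¬(vertexMultiset P).Nodup).card : ℤ) = 0 := by
  simp only [Finset.cast_card, Finset.mul_sum, mul_one]
  rw [Finset.sum_sigma']
  have hmem : ∀ x : (Σ _ : Equiv.Perm (Fin p), Fin p → List (ℤ × ℤ)),
      x ∈ Finset.univ.sigma (fun π : Equiv.Perm (Fin p) =>
        (Fintype.piFinset fun k => latticePaths (A (π k)) (E k)).filter
          fun P => ¬(vertexMultiset P).Nodup) ↔
      (∀ k, IsLatticePath (A (x.1 k)) (E k) (x.2 k)) ∧ ¬(vertexMultiset x.2).Nodup := by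
    intro x
    simp [mem_latticePaths]
  have hsign : ∀ x : (Σ _ : Equiv.Perm (Fin p), Fin p → List (ℤ × ℤ)),
      (∀ k, IsLatticePath (A (x.1 k)) (E k) (x.2 k)) → ¬(vertexMultiset x.2).Nodup →
      Equiv.Perm.sign (x.1 * intersectionSwap x.2) = -Equiv.Perm.sign x.1 := by
    intro x h1 h2
    obtain ⟨i, j, hij, e, -⟩ := intersectionSwap_spec (fun k => (h1 k).nodup) h2
    rw [e, Equiv.Perm.sign_mul, Equiv.Perm.sign_swap hij, mul_neg_one]
  refine Finset.sum_involution (fun x _ => ⟨x.1 * intersectionSwap x.2, spliceFamily x.2⟩) ?_ ?_ ?_ ?_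
  · intro x hx
    rw [hmem] at hx
    rw [hsign x hx.1 hx.2]
    simp
  · intro x hx _ h
    rw [hmem] at hx
    have h1 := hsign x hx.1 hx.2
    have h2 : x.1 * intersectionSwap x.2 = x.1 := congrArg Sigma.fst h
    rw [h2] at h1
    exact units_ne_neg_self _ h1
  · intro x hx
    rw [hmem] at hx ⊢
    refine ⟨fun k => ?_, by rw [vertexMultiset_spliceFamily]; exact hx.2⟩
    exact isLatticePath_spliceFamily (A := fun k => A (x.1 k)) hx.1 hx.2 k
  · rintro ⟨π, P⟩ hx
    rw [hmem] at hx
    have hP := fun k => (hx.1 k).nodup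
    obtain ⟨i, j, -, e, -⟩ := intersectionSwap_spec hP hx.2
    dsimp only
    rw [intersectionSwap_spliceFamily, spliceFamily_spliceFamily hP hx.2, e, mul_assoc,
      Equiv.swap_mul_self, mul_one]

/-- The Lindström–Gessel–Viennot lemma for lattice paths, without any compatibility condition on
the end points: the determinant of path counts is a signed count of nonintersecting families. -/
theorem sum_sign_prod_pathCount {p : ℕ} (A E : Fin p → ℤ × ℤ) :
    ∑ π : Equiv.Perm (Fin p), (Equiv.Perm.sign π : ℤ) * ∏ k, (pathCount (A (π k)) (E k) : ℤ) =
      ∑ π : Equiv.Perm (Fin p), (Equiv.Perm.sign π : ℤ) *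
        (disjointCount (fun k => A (π k)) E : ℤ) := by
  rw [← add_zero (∑ π : Equiv.Perm (Fin p), (Equiv.Perm.sign π : ℤ) *
        (disjointCount (fun k => A (π k)) E : ℤ)), ← sum_sign_intersecting_eq_zero A E,
    ← Finset.sum_add_distrib]
  refine Finset.sum_congr rfl fun π _ => ?_
  rw [disjointCount_eq_card, ← mul_add, ← Nat.cast_add, Finset.card_filter_add_card_filter_not,
    Fintype.card_piFinset]
  simp [pathCount_eq_card]

/-! ### Labelings of the starting points -/

/-- A skew-symmetric form on labels. The labels `Sum.inl k` stand for the end points, of which the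
first `q` (the points `S`) are isotropic among end points, while the remaining `r` (the points `I`)
are paired with each other by the sign of their order. The labels `Sum.inr j` stand for the last
`q` rows of the block matrix; each is dual to the end point `j`. -/
def labelForm (q r : ℕ) : Fin (q + r) ⊕ Fin q → Fin (q + r) ⊕ Fin q → ℤ
  | .inl k, .inl l =>
    if q ≤ (k : ℕ) ∧ q ≤ (l : ℕ) then (if k < l then 1 else 0) - (if l < k then 1 else 0) else 0
  | .inl k, .inr j => if (k : ℕ) = j then 1 else 0
  | .inr j, .inl k => -if (k : ℕ) = j then 1 else 0
  | .inr _, .inr _ => 0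

theorem labelForm_skew {q r : ℕ} (k l : Fin (q + r) ⊕ Fin q) :
    labelForm q r k l = -labelForm q r l k := by
  rcases k with k | k <;> rcases l with l | l <;> simp only [labelForm, neg_neg, neg_zero]
  simp only [and_comm (a := q ≤ (l : ℕ))]
  split_ifs <;> simp

/-- The coordinates of the rows of the block matrix with respect to the labels. -/
noncomputable def labelMatrix {p q r : ℕ} (A : Fin p → ℤ × ℤ) (E : Fin (q + r) → ℤ × ℤ) :
    Fin (p + q) → Fin (q + r) ⊕ Fin q → ℤ :=
  Fin.append (fun i => Sum.elim (fun k => (pathCount (A i) (E k) : ℤ)) fun _ => 0)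
    fun j => Sum.elim (fun _ => 0) (Pi.single j 1)

theorem matrixQ_apply {p r : ℕ} (A : Fin p → ℤ × ℤ) (I : Fin r → ℤ × ℤ) (i j : Fin p) :
    matrixQ A I i j = ∑ s, ∑ t, (pathCount (A i) (I s) : ℤ) *
      ((if s < t then 1 else 0) - (if t < s then 1 else 0)) * pathCount (A j) (I t) := by
  have h : ∀ f : Fin r → Fin r → ℤ,
      ∑ s, ∑ t ∈ Finset.Ioi s, f s t = ∑ s, ∑ t, if s < t then f s t else 0 := by
    intro f
    refine Finset.sum_congr rfl fun s _ => ?_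
    rw [← Finset.sum_filter]
    refine Finset.sum_congr ?_ fun _ _ => rfl
    ext t; simp
  simp only [matrixQ, Matrix.of_apply, Finset.sum_sub_distrib, h, mul_sub, sub_mul]
  congr 1
  · refine Finset.sum_congr rfl fun s _ => Finset.sum_congr rfl fun t _ => ?_
    split_ifs <;> ring
  · rw [Finset.sum_comm]
    refine Finset.sum_congr rfl fun s _ => Finset.sum_congr rfl fun t _ => ?_
    split_ifs <;> ring

theorem blockMatrix_eq_labelForm {p q r : ℕ} (A : Fin p → ℤ × ℤ) (S : Fin q → ℤ × ℤ)
    (I : Fin r → ℤ × ℤ) :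
    blockMatrix A S I = Matrix.of fun u v => ∑ k, ∑ l,
      labelMatrix A (Fin.append S I) u k * labelForm q r k l *
        labelMatrix A (Fin.append S I) v l := by
  have hS : ∀ k : Fin q, ¬ q ≤ (k : ℕ) := fun k => by omega
  have hI : ∀ (s : Fin r) (k : Fin q), q + (s : ℕ) ≠ k := fun s k => by omega
  ext u v
  refine Fin.addCases (fun i => ?_) (fun i => ?_) u <;>
    refine Fin.addCases (fun j => ?_) (fun j => ?_) v
  · simp [blockMatrix, labelMatrix, labelForm, Fin.sum_univ_add, matrixQ_apply, hS]
  · simp [blockMatrix, labelMatrix, labelForm, Fin.sum_univ_add, matrixH, Pi.single_apply,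
      Fin.val_inj, hI]
  · simp [blockMatrix, labelMatrix, labelForm, Fin.sum_univ_add, matrixH, Pi.single_apply,
      Fin.val_inj, hI]
  · simp [blockMatrix, labelMatrix, labelForm, Fin.sum_univ_add]

/-- The coefficient of `∏ i, pathCount (A i) (E (f i))` in the Pfaffian of the block matrix, for a
choice `f` of an end point for each starting point. -/
def labelPfaffian {p q r : ℕ} (f : Fin p → Fin (q + r)) : ℤ :=
  pfaffian (Matrix.of fun u v : Fin (p + q) =>
    labelForm q r (Fin.append (Sum.inl ∘ f) Sum.inr u) (Fin.append (Sum.inl ∘ f) Sum.inr v))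

theorem pfaffian_blockMatrix_eq_sum {p q r : ℕ} (A : Fin p → ℤ × ℤ) (S : Fin q → ℤ × ℤ)
    (I : Fin r → ℤ × ℤ) :
    pfaffian (blockMatrix A S I) = ∑ f : Fin p → Fin (q + r),
      (∏ i, (pathCount (A i) (Fin.append S I (f i)) : ℤ)) * labelPfaffian f := by
  rw [blockMatrix_eq_labelForm, pfaffian_mul_mul_transpose]
  symm
  refine Finset.sum_of_injOn (fun f => Fin.append (Sum.inl ∘ f) Sum.inr) ?_ ?_ ?_ ?_
  · intro f _ g _ h
    funext i
    simpa using congrFun h (Fin.castAdd q i)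
  · simp
  · intro F _ hF
    refine mul_eq_zero_of_left (by_contra fun h => hF ?_) _
    rw [← ne_eq, Finset.prod_ne_zero_iff] at h
    have h1 : ∀ i : Fin p, ∃ k, F (Fin.castAdd q i) = Sum.inl k := by
      intro i
      have := h (Fin.castAdd q i) (Finset.mem_univ _)
      rcases hk : F (Fin.castAdd q i) with k | k
      · exact ⟨k, rfl⟩
      · simp [labelMatrix, hk] at this
    have h2 : ∀ j : Fin q, F (Fin.natAdd p j) = Sum.inr j := by
      intro j
      have := h (Fin.natAdd p j) (Finset.mem_univ _)
      rcases hk : F (Fin.natAdd p j) with k | k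
      · simp [labelMatrix, hk] at this
      · simp [labelMatrix, hk, Pi.single_apply] at this
        rw [this]
    choose f hf using h1
    refine ⟨f, by simp, ?_⟩
    funext u
    refine Fin.addCases (fun i => ?_) (fun j => ?_) u <;> simp [hf, h2]
  · intro f _
    rw [Fin.prod_univ_add]
    simp [labelMatrix, labelPfaffian]

theorem labelPfaffian_comp_perm {p q r : ℕ} (f : Fin p → Fin (q + r)) (π : Equiv.Perm (Fin p)) :
    labelPfaffian (f ∘ π) = (Equiv.Perm.sign π : ℤ) * labelPfaffian f := by
  set ρ : Equiv.Perm (Fin (p + q)) :=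
    finSumFinEquiv.permCongr (Equiv.Perm.sumCongr π (1 : Equiv.Perm (Fin q))) with hρ
  have hs : Equiv.Perm.sign ρ = Equiv.Perm.sign π := by simp [hρ]
  have hc : ∀ u : Fin (p + q), (Fin.append (Sum.inl ∘ f ∘ π) Sum.inr u : Fin (q + r) ⊕ Fin q) =
      Fin.append (Sum.inl ∘ f) Sum.inr (ρ u) := by
    intro u
    refine Fin.addCases (fun i => ?_) (fun j => ?_) u <;> simp [hρ]
  rw [← hs]
  unfold labelPfaffian
  refine Eq.trans ?_ (pfaffian_submatrix_perm (M := Matrix.of fun u v : Fin (p + q) =>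
    labelForm q r (Fin.append (Sum.inl ∘ f) Sum.inr u) (Fin.append (Sum.inl ∘ f) Sum.inr v))
    (fun _ _ => labelForm_skew _ _) ρ)
  congr 1
  ext u v
  simp only [hc, Matrix.of_apply, Matrix.submatrix_apply]

/-- Exchanging two starting points with the same label changes the sign but not the Pfaffian. -/
theorem labelPfaffian_eq_zero_of_not_injective {p q r : ℕ} {f : Fin p → Fin (q + r)}
    (hf : ¬Function.Injective f) : labelPfaffian f = 0 := by
  simp only [Function.Injective, not_forall] at hf
  obtain ⟨i, j, hij, hne⟩ := hf
  have h := labelPfaffian_comp_perm f (Equiv.swap i j)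
  have : f ∘ Equiv.swap i j = f := by
    funext k
    simp only [Function.comp_apply, Equiv.swap_apply_def]
    split_ifs with h1 h2
    · rw [h1, hij]
    · rw [h2, hij]
    · rfl
  rw [this, Equiv.Perm.sign_swap hne] at h
  simp at h
  omega

theorem pfaffian_eq_zero_of_row_eq_zero {R : Type*} [CommRing R] {m : ℕ}
    {M : Matrix (Fin m) (Fin m) R} (u : Fin m) (h1 : ∀ v, M u v = 0) (h2 : ∀ v, M v u = 0) :
    pfaffian M = 0 := by
  refine Finset.sum_eq_zero fun σ hσ => mul_eq_zero_of_right _ ?_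
  have hm := mem_perfectMatchings.1 hσ u
  by_cases hu : u < σ u
  · exact Finset.prod_eq_zero (i := u) (by simpa using hu) (h1 _)
  · refine Finset.prod_eq_zero (i := σ u) ?_ (by rw [hm.1, h2])
    simpa [hm.1] using lt_of_le_of_ne (not_lt.1 hu) hm.2

theorem labelPfaffian_eq_zero_of_not_mem_range {p q r : ℕ} {f : Fin p → Fin (q + r)} {j : Fin q}
    (hj : ∀ k, f k ≠ Fin.castAdd r j) : labelPfaffian f = 0 := by
  have hj' : ∀ k, (f k : ℕ) ≠ j := fun k h => hj k (Fin.ext h)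
  refine pfaffian_eq_zero_of_row_eq_zero (Fin.natAdd p j) (fun v => ?_) fun v => ?_ <;>
    refine Fin.addCases (fun i => ?_) (fun i => ?_) v <;> simp [labelForm, hj']

open Classical in
/-- The labelings in increasing order that use each of the first `q` labels. -/
noncomputable def sortedLabelings (p q r : ℕ) : Finset (Fin p → Fin (q + r)) :=
  Finset.univ.filter fun h => StrictMono h ∧ ∀ j : Fin q, ∃ k, h k = Fin.castAdd r j

theorem mem_sortedLabelings {p q r : ℕ} {h : Fin p → Fin (q + r)} :
    h ∈ sortedLabelings p q r ↔ StrictMono h ∧ ∀ j : Fin q, ∃ k, h k = Fin.castAdd r j := by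
  simp [sortedLabelings]

theorem StrictMono.val_le_fin {a b : ℕ} {f : Fin a → Fin b} (hf : StrictMono f) (k : Fin a) :
    (k : ℕ) ≤ f k := by
  obtain ⟨n, hn⟩ := k
  induction n with
  | zero => exact Nat.zero_le _
  | succ n ih =>
    have h1 := ih (by omega)
    have h2 : f ⟨n, by omega⟩ < f ⟨n + 1, hn⟩ := hf (by simp)
    rw [Fin.lt_def] at h2
    dsimp only at h1 ⊢
    omega

/-- A sorted labeling assigns to the first `q` starting points their own indices. -/
theorem sortedLabelings_spec {p q r : ℕ} {h : Fin p → Fin (q + r)}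
    (hh : h ∈ sortedLabelings p q r) :
    q ≤ p ∧ (∀ k : Fin p, (k : ℕ) < q → (h k : ℕ) = k) ∧
      ∀ k : Fin p, q ≤ (k : ℕ) → q ≤ (h k : ℕ) := by
  obtain ⟨hm, hr⟩ := mem_sortedLabelings.1 hh
  choose g hg using hr
  have hgm : StrictMono g := by
    intro i j hij
    rw [← hm.lt_iff_lt, hg, hg]
    exact hij
  have hgj : ∀ j, (g j : ℕ) = j := by
    intro j
    have h1 := hgm.val_le_fin j
    have h2 := hm.val_le_fin (g j)
    rw [hg, Fin.val_castAdd] at h2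
    omega
  refine ⟨by simpa using Fintype.card_le_of_injective g hgm.injective, fun k hk => ?_,
    fun k hk => hk.trans (hm.val_le_fin k)⟩
  have : k = g ⟨k, hk⟩ := Fin.ext (hgj ⟨k, hk⟩).symm
  conv_lhs => rw [this, hg]
  rfl

/-- In a sorted labeling the first `q` starting points are matched, in order, with the last `q`
rows, and any two of the other starting points contribute `1`. -/
theorem labelPfaffian_of_mem_sortedLabelings {p q r : ℕ} (hpq : Even (p + q))
    {h : Fin p → Fin (q + r)} (hh : h ∈ sortedLabelings p q r) :
    labelPfaffian h = (-1) ^ q.choose 2 := by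
  obtain ⟨hqp, h1, h2⟩ := sortedLabelings_spec hh
  have hm := (mem_sortedLabelings.1 hh).1
  obtain ⟨n, hn⟩ : ∃ n, p = 2 * n + q := by
    obtain ⟨c, hc⟩ := hpq
    exact ⟨c - q, by omega⟩
  rw [← pfaffian_standardEntry q n (p + q) (by omega)]
  refine pfaffian_congr fun u v => ?_
  refine Fin.addCases (fun i => ?_) (fun i => ?_) u <;>
    refine Fin.addCases (fun j => ?_) (fun j => ?_) v <;> intro huv
  · have hij : i < j := huv
    have hlt := hm hij
    have a1 := h1 i
    have a2 := h2 i
    have a3 := j.2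
    simp only [Matrix.of_apply, Fin.append_left, Function.comp_apply, labelForm, standardEntry,
      Fin.val_castAdd, hlt, hlt.not_gt, if_true, if_false, sub_zero]
    simp only [Fin.lt_def] at hlt hij
    refine if_congr ?_ rfl rfl
    omega
  · have a1 := h1 i
    have a2 := h2 i
    simp only [Matrix.of_apply, Fin.append_left, Fin.append_right, Function.comp_apply, labelForm,
      standardEntry, Fin.val_castAdd, Fin.val_natAdd]
    refine if_congr ?_ rfl rfl
    omega
  · simp only [Fin.lt_def, Fin.val_castAdd, Fin.val_natAdd] at huv
    omega
  · simp only [Matrix.of_apply, Fin.append_right, labelForm, standardEntry, Fin.val_natAdd]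
    rw [if_neg]
    omega

/-- Each injective labeling is a sorted one composed with a unique permutation. -/
theorem sum_injective_eq_sum_strictMono {p N : ℕ} (g : (Fin p → Fin N) → ℤ)
    [DecidablePred (Function.Injective : (Fin p → Fin N) → Prop)]
    [DecidablePred (StrictMono : (Fin p → Fin N) → Prop)] :
    ∑ f with Function.Injective f, g f =
      ∑ h with StrictMono h, ∑ π : Equiv.Perm (Fin p), g (h ∘ π) := by
  rw [← Finset.sum_product']
  symm
  refine Finset.sum_nbij (fun x => x.1 ∘ x.2) ?_ ?_ ?_ fun _ _ => rfl
  · rintro ⟨h, π⟩ hx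
    simp only [Finset.mem_product, Finset.mem_filter, Finset.mem_univ, true_and, and_true] at hx ⊢
    exact hx.injective.comp π.injective
  · rintro ⟨h, π⟩ hx ⟨h', π'⟩ hx' e
    simp only [Finset.coe_product, Set.mem_prod, Finset.coe_filter, Finset.mem_univ, true_and,
      Set.mem_ofPred_eq, Finset.coe_univ, Set.mem_univ, and_true] at hx hx' e
    have e1 : (h ∘ π) ∘ (π⁻¹ : Equiv.Perm (Fin p)) = h := by funext k; simp
    have e2 : (h ∘ π) ∘ (π'⁻¹ : Equiv.Perm (Fin p)) = h' := by rw [e]; funext k; simp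
    have hh : h = h' := by
      rw [← e1, ← e2]
      exact Tuple.unique_monotone (by rw [e1]; exact hx.monotone) (by rw [e2]; exact hx'.monotone)
    subst hh
    rw [Prod.mk.injEq]
    exact ⟨rfl, Equiv.ext fun k => hx.injective (congrFun e k)⟩
  · intro f hf
    simp only [Finset.coe_filter, Finset.mem_univ, true_and, Set.mem_ofPred_eq] at hf
    refine ⟨(f ∘ Tuple.sort f, (Tuple.sort f)⁻¹), ?_, by funext k; simp⟩
    simp only [Finset.coe_product, Set.mem_prod, Finset.coe_filter, Finset.mem_univ, true_and,
      Set.mem_ofPred_eq, Finset.coe_univ, Set.mem_univ, and_true]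
    exact (Tuple.monotone_sort f).strictMono_of_injective (hf.comp (Tuple.sort f).injective)

theorem pfaffian_blockMatrix_eq_sum_sortedLabelings {p q r : ℕ} (hpq : Even (p + q))
    (A : Fin p → ℤ × ℤ) (S : Fin q → ℤ × ℤ) (I : Fin r → ℤ × ℤ) :
    pfaffian (blockMatrix A S I) = (-1) ^ q.choose 2 * ∑ h ∈ sortedLabelings p q r,
      ∑ π : Equiv.Perm (Fin p), (Equiv.Perm.sign π : ℤ) *
        ∏ k, (pathCount (A (π k)) (Fin.append S I (h k)) : ℤ) := by
  classical
  rw [pfaffian_blockMatrix_eq_sum, ← Finset.sum_filter_of_ne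
    (p := fun f => Function.Injective f) fun f _ hf => by_contra fun h =>
      hf (mul_eq_zero_of_right _ (labelPfaffian_eq_zero_of_not_injective h)),
    sum_injective_eq_sum_strictMono, Finset.mul_sum]
  symm
  refine Finset.sum_subset_zero_on_sdiff ?_ ?_ ?_
  · intro h hh
    simpa using (mem_sortedLabelings.1 hh).1
  · intro h hh
    simp only [Finset.mem_sdiff, Finset.mem_filter, Finset.mem_univ, true_and,
      mem_sortedLabelings, not_and, not_forall, not_exists] at hh
    obtain ⟨j, hj⟩ := hh.2 hh.1
    refine Finset.sum_eq_zero fun π _ => ?_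
    rw [labelPfaffian_comp_perm, labelPfaffian_eq_zero_of_not_mem_range hj, mul_zero, mul_zero]
  · intro h hh
    rw [Finset.mul_sum]
    refine Fintype.sum_equiv (Equiv.inv _) _ _ fun π => ?_
    rw [labelPfaffian_comp_perm, labelPfaffian_of_mem_sortedLabelings hpq hh]
    rw [← Equiv.prod_comp π fun i => (pathCount (A i) _ : ℤ)]
    simp
    ring

/-! ### The end points of nonintersecting families -/

/-- The end points of a nonintersecting family, in the order of its paths, form a sorted
labeling. -/
theorem isNonintFamily_iff {p q r : ℕ} {A : Fin p → ℤ × ℤ} {S : Fin q → ℤ × ℤ}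
    {I : Fin r → ℤ × ℤ} {P : Fin p → List (ℤ × ℤ)} :
    IsNonintFamily A S I P ↔ ∃ h ∈ sortedLabelings p q r,
      (∀ k, IsLatticePath (A k) (Fin.append S I (h k)) (P k)) ∧
        Pairwise fun k l => (P k).Disjoint (P l) := by
  constructor
  · rintro ⟨hS, ⟨j, hj, hI⟩, hd⟩
    let h : Fin p → Fin (q + r) := fun k =>
      if hk : (k : ℕ) < q then Fin.castAdd r ⟨k, hk⟩ else Fin.natAdd q (j ⟨k, not_lt.1 hk⟩)
    have hlt : ∀ (k : Fin p) (hk : (k : ℕ) < q), h k = Fin.castAdd r ⟨k, hk⟩ :=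
      fun k hk => dif_pos hk
    have hge : ∀ (k : Fin p) (hk : ¬(k : ℕ) < q), h k = Fin.natAdd q (j ⟨k, not_lt.1 hk⟩) :=
      fun k hk => dif_neg hk
    refine ⟨h, mem_sortedLabelings.2 ⟨?_, fun k => ⟨⟨k, (hS k).1⟩, hlt _ k.2⟩⟩, ?_, hd⟩
    · intro k l hkl
      rw [Fin.lt_def] at hkl
      by_cases hk : (k : ℕ) < q <;> by_cases hl : (l : ℕ) < q
      · rw [hlt k hk, hlt l hl]
        exact hkl
      · rw [hlt k hk, hge l hl, Fin.lt_def, Fin.val_castAdd, Fin.val_natAdd]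
        omega
      · omega
      · have := @hj ⟨k, not_lt.1 hk⟩ ⟨l, not_lt.1 hl⟩ hkl
        rw [hge k hk, hge l hl]
        simpa using this
    · intro k
      by_cases hk : (k : ℕ) < q
      · simpa [hlt k hk, -Fin.castAdd_mk] using (hS ⟨k, hk⟩).2
      · simpa [hge k hk] using hI ⟨k, not_lt.1 hk⟩
  · rintro ⟨h, hh, hP, hd⟩
    obtain ⟨hqp, h1, h2⟩ := sortedLabelings_spec hh
    refine ⟨fun k => ⟨by omega, ?_⟩, ⟨fun k => ⟨h k - q, ?_⟩, ?_, ?_⟩, hd⟩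
    · have e : h ⟨k, by omega⟩ = Fin.castAdd r k := Fin.ext (h1 ⟨k, by omega⟩ k.2)
      have := hP ⟨k, by omega⟩
      rwa [e, Fin.append_left] at this
    · have := h2 k k.2
      omega
    · intro k l hkl
      have a1 := (mem_sortedLabelings.1 hh).1 (show (k : Fin p) < l from hkl)
      have a2 := h2 k k.2
      rw [Fin.lt_def] at a1 ⊢
      dsimp only
      omega
    · intro k
      have a2 := h2 k k.2
      have e : h k = Fin.natAdd q ⟨h k - q, by omega⟩ := Fin.ext (by simp; omega)
      have := hP k
      rwa [e, Fin.append_right] at this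

theorem sortedLabelings_eq_of_endpoints {p q r : ℕ} {S : Fin q → ℤ × ℤ} {I : Fin r → ℤ × ℤ}
    (hI : Function.Injective I) {h h' : Fin p → Fin (q + r)} (hh : h ∈ sortedLabelings p q r)
    (hh' : h' ∈ sortedLabelings p q r)
    (e : ∀ k, Fin.append S I (h k) = Fin.append S I (h' k)) : h = h' := by
  obtain ⟨-, h1, h2⟩ := sortedLabelings_spec hh
  obtain ⟨-, h1', h2'⟩ := sortedLabelings_spec hh'
  funext k
  by_cases hk : (k : ℕ) < q
  · exact Fin.ext ((h1 k hk).trans (h1' k hk).symm)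
  · have a := h2 k (not_lt.1 hk)
    have a' := h2' k (not_lt.1 hk)
    obtain ⟨s, hs⟩ : ∃ s, h k = Fin.natAdd q s :=
      ⟨⟨h k - q, by omega⟩, Fin.ext (by simp; omega)⟩
    obtain ⟨s', hs'⟩ : ∃ s, h' k = Fin.natAdd q s :=
      ⟨⟨h' k - q, by omega⟩, Fin.ext (by simp; omega)⟩
    have := e k
    rw [hs, hs', Fin.append_right, Fin.append_right] at this
    rw [hs, hs', hI this]

theorem IsLatticePath.end_unique {a a' e e' : ℤ × ℤ} {l : List (ℤ × ℤ)}
    (h : IsLatticePath a e l) (h' : IsLatticePath a' e' l) : e = e' :=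
  Option.some.inj (h.2.1.symm.trans h'.2.1)

theorem nonintCount_eq_sum {p q r : ℕ} (A : Fin p → ℤ × ℤ) (S : Fin q → ℤ × ℤ)
    {I : Fin r → ℤ × ℤ} (hI : Function.Injective I) :
    nonintCount A S I =
      ∑ h ∈ sortedLabelings p q r, disjointCount A fun k => Fin.append S I (h k) := by
  classical
  simp only [disjointCount_eq_card]
  rw [nonintCount, ← Finset.card_biUnion, ← Set.ncard_coe_finset]
  · congr 1
    ext P
    simp only [Set.mem_ofPred_eq, isNonintFamily_iff, Finset.coe_biUnion, Set.mem_iUnion,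
      Finset.coe_filter, Fintype.mem_piFinset, mem_latticePaths, Finset.mem_coe, exists_prop]
    refine exists_congr fun h => and_congr_right fun _ => and_congr_right fun hP => ?_
    exact (nodup_vertexMultiset_iff fun k => (hP k).nodup).symm
  · intro h hh h' hh' hne
    refine Finset.disjoint_left.2 fun P hP hP' => hne ?_
    simp only [Finset.mem_filter, Fintype.mem_piFinset, mem_latticePaths] at hP hP'
    exact sortedLabelings_eq_of_endpoints hI hh hh' fun k => (hP.1 k).end_unique (hP'.1 k)

theorem theorem5 (p q r : ℕ) (hpq : Even (p + q)) (A : Fin p → ℤ × ℤ) (S : Fin q → ℤ × ℤ)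
    (I : Fin r → ℤ × ℤ) (hI : Function.Injective I) :
    pfaffian (blockMatrix A S I) =
      (-1) ^ q.choose 2 *
        ∑ π : Equiv.Perm (Fin p),
          (Equiv.Perm.sign π : ℤ) * (nonintCount (fun k => A (π k)) S I : ℤ) := by
  rw [pfaffian_blockMatrix_eq_sum_sortedLabelings hpq]
  congr 1
  simp only [nonintCount_eq_sum _ _ hI, Nat.cast_sum, Finset.mul_sum]
  conv_rhs => rw [Finset.sum_comm]
  exact Finset.sum_congr rfl fun h _ =>
    sum_sign_prod_pathCount A fun k => Fin.append S I (h k)
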